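/- For $n\ge 0$ let $S_n$ be the set of permutations $w=w(1)\cdots w(n)$ of $\{1,\dots,n\}$, with $S_0=\{\emptyset\}$. For $1\le i<n$ let $s_i$ be the transposition of $i$ and $i+1$, so that $ws_i$ is obtained from $w$ by swapping the entries $w(i)$ and $w(i+1)$. On $\mathbb{Z}[\beta][x_1,\dots,x_n]$ let $\partial_i f=(f-s_i\cdot f)/(x_i-x_{i+1})$, where $s_i\cdot f$ is $f$ with $x_i$ and $x_{i+1}$ interchanged, and let $\pi_i f=\partial_i\big((1+\beta x_{i+1})f\big)$. The $\beta$-Grothendieck polynomials $\mathfrak{G}^{(\beta)}_w(x)$, $w\in S_n$, are defined by $\mathfrak{G}^{(\beta)}_{w_0}(x)=x_1^{n-1}x_2^{n-2}\cdots x_{n-1}$ for $w_0=n\cdots 21$, and $\mathfrak{G}^{(\beta)}_w(x)=\pi_i\,\mathfrak{G}^{(\beta)}_{ws_i}(x)$ for any $i$ with $w(i)<w(i+1)$ (the result does not depend on the choice of $i$). Let $\Upsilon_w(\beta)=\mathfrak{G}^{(\beta)}_w(1,\dots,1)\in\mathbb{Z}[\beta]$. For $v\in S_m$ and $w\in S_n$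 let $p_v(w)$ be the number of choices of positions $1\le i_1<\cdots<i_m\le n$ such that $w(i_1)\cdots w(i_m)$ has the same relative order as $v(1)\cdots v(m)$; in particular $p_\emptyset(w)=1$. Define $c_w(\beta)\in\mathbb{Z}[\beta]$ recursively by $c_\emptyset(\beta)=1$ and, for $w\in S_n$ with $n\ge 1$, $$c_w(\beta)=\Upsilon_w(\beta)-\sum_{\substack{v\in S_m\\ 0\le m<n}}c_v(\beta)\,p_v(w).$$ **Inverse conservation principle.** For every $n\ge 0$ and every permutation $w\in S_n$, $c_w(\beta)=c_{w^{-1}}(\beta)$. -/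

import Mathlib

/-! Permutations `w ∈ S_n` are `w : Equiv.Perm (Fin n)`, so positions, values and the variables
`x_1, …, x_n` are indexed from `0`. The parameter `β` is `Polynomial.X : Polynomial ℤ`, and
`ℤ[β][x_1, …, x_n]` is `MvPolynomial (Fin n) (Polynomial ℤ)`. -/

namespace GrothendieckSpecialization

/-- `ℤ[β][x_1, …, x_n]`. -/
abbrev PolyRing (n : ℕ) : Type := MvPolynomial (Fin n) (Polynomial ℤ)

/-- The parameter `β`, as a constant of `ℤ[β][x_1, …, x_n]`. -/
noncomputable def beta (n : ℕ) : PolyRing n := MvPolynomial.C Polynomial.X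

/-- The action `w · f = f(x_{w(1)}, …, x_{w(n)})`. -/
noncomputable def act {n : ℕ} (w : Equiv.Perm (Fin n)) (f : PolyRing n) : PolyRing n :=
  MvPolynomial.rename w f

theorem X_sub_X_dvd {n : ℕ} (i j : Fin n) (f : PolyRing n) :
    (MvPolynomial.X i - MvPolynomial.X j : PolyRing n) ∣ f - act (Equiv.swap i j) f := by
  rw [← Ideal.mem_span_singleton, ← Ideal.Quotient.mk_eq_mk_iff_sub_mem]
  set I : Ideal (PolyRing n) := Ideal.span {MvPolynomial.X i - MvPolynomial.X j} with hI
  have hij : Ideal.Quotient.mk I (MvPolynomial.X i) = Ideal.Quotient.mk I (MvPolynomial.X j) := by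
    rw [Ideal.Quotient.mk_eq_mk_iff_sub_mem]
    exact Ideal.mem_span_singleton_self _
  have h : (Ideal.Quotient.mkₐ (Polynomial ℤ) I) =
      (Ideal.Quotient.mkₐ (Polynomial ℤ) I).comp (MvPolynomial.rename (Equiv.swap i j)) := by
    refine MvPolynomial.algHom_ext fun k => ?_
    simp only [AlgHom.comp_apply, MvPolynomial.rename_X, Ideal.Quotient.mkₐ_eq_mk]
    rw [Equiv.swap_apply_def]
    split_ifs with h1 h2
    · rw [h1, hij]
    · rw [h2, hij]
    · rfl
  exact DFunLike.congr_fun h f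

/-- The divided difference `(f - s · f) / (x_i - x_j)`, where `s` is the transposition of
`i ≠ j`; it is used for `j = i + 1`. -/
noncomputable def divDiff {n : ℕ} (i j : Fin n) (f : PolyRing n) : PolyRing n :=
  Classical.choose (X_sub_X_dvd i j f)

theorem divDiff_spec {n : ℕ} (i j : Fin n) (f : PolyRing n) :
    (MvPolynomial.X i - MvPolynomial.X j) * divDiff i j f = f - act (Equiv.swap i j) f :=
  (Classical.choose_spec (X_sub_X_dvd i j f)).symm

/-- The operator `π_i = ∂_i (1 + β x_{i+1})`, with `j = i + 1`. -/
noncomputable def isobaric {n : ℕ} (i j : Fin n) (f : PolyRing n) : PolyRing n :=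
  divDiff i j ((1 + beta n * MvPolynomial.X j) * f)

/-- `i` is an ascent of `w`: `i` and `i + 1` are positions of `w` and `w(i) < w(i+1)`. -/
def IsAscent {n : ℕ} (w : Equiv.Perm (Fin n)) (i : ℕ) : Prop :=
  ∃ h : i + 1 < n, w ⟨i, Nat.lt_of_succ_lt h⟩ < w ⟨i + 1, h⟩

instance {n : ℕ} (w : Equiv.Perm (Fin n)) : DecidablePred (IsAscent w) := fun i =>
  inferInstanceAs (Decidable (∃ h : i + 1 < n, w ⟨i, Nat.lt_of_succ_lt h⟩ < w ⟨i + 1, h⟩))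

/-- The simple transposition `s_i` of `S_n` swapping `i` and `i + 1`. -/
def simpleSwap {n : ℕ} (i : ℕ) (h : i + 1 < n) : Equiv.Perm (Fin n) :=
  Equiv.swap ⟨i, Nat.lt_of_succ_lt h⟩ ⟨i + 1, h⟩

/-- Every `w` different from the longest permutation `w₀` has an ascent. -/
theorem exists_isAscent {n : ℕ} {w : Equiv.Perm (Fin n)} (hw : w ≠ Fin.revPerm) :
    ∃ i, IsAscent w i := by
  by_contra hno
  refine hw ?_
  cases n with
  | zero => exact Subsingleton.elim _ _
  | succ n =>
    have hanti : StrictAnti w := by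
      refine Fin.strictAnti_iff_succ_lt.2 fun i => ?_
      have h1 : ¬ w i.castSucc < w i.succ := fun h =>
        hno ⟨i, ⟨Nat.succ_lt_succ i.isLt, h⟩⟩
      refine lt_of_le_of_ne (not_lt.1 h1) fun h => ?_
      have := w.injective h
      simp [Fin.ext_iff] at this
    have hmono : StrictMono fun x => w (Fin.rev x) := fun a b hab => hanti (Fin.rev_lt_rev.2 hab)
    have hsurj : Function.Surjective fun x => w (Fin.rev x) :=
      w.surjective.comp Fin.rev_surjective
    ext x
    have hx := DFunLike.congr_fun (Subsingleton.elim (hmono.orderIsoOfSurjective _ hsurj)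
      (OrderIso.refl (Fin (n + 1)))) (Fin.rev x)
    simp only [StrictMono.coe_orderIsoOfSurjective, Fin.rev_rev, OrderIso.refl_apply] at hx
    rw [hx, Fin.revPerm_apply]

/-- The number of pairs of positions `a < b` with `w(a) < w(b)`, that is, `ℓ(w₀) - ℓ(w)`. -/
def colength {n : ℕ} (w : Equiv.Perm (Fin n)) : ℕ :=
  (Finset.univ.filter fun p : Fin n × Fin n => p.1 < p.2 ∧ w p.1 < w p.2).card

theorem colength_mul_simpleSwap_lt {n : ℕ} (w : Equiv.Perm (Fin n)) (i : ℕ) (h : i + 1 < n)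
    (hw : w ⟨i, Nat.lt_of_succ_lt h⟩ < w ⟨i + 1, h⟩) :
    colength (w * simpleSwap i h) < colength w := by
  set s := simpleSwap i h with hs
  unfold colength
  rw [← Finset.card_map (Equiv.prodCongr s s).toEmbedding]
  refine Finset.card_lt_card (Finset.ssubset_iff_subset_ne.2 ⟨?_, ?_⟩)
  · intro p hp
    obtain ⟨⟨a, b⟩, hab, rfl⟩ := Finset.mem_map.1 hp
    replace hab := (Finset.mem_filter.1 hab).2
    simp only [Equiv.Perm.mul_apply] at hab
    simp only [Finset.mem_filter, Finset.mem_univ, true_and, Equiv.coe_toEmbedding,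
      Equiv.prodCongr_apply, Prod.map_apply]
    refine ⟨?_, hab.2⟩
    obtain ⟨h1, h2⟩ := hab
    rw [hs, simpleSwap] at h2 ⊢
    simp only [Equiv.swap_apply_def, Fin.ext_iff, Fin.lt_def] at h1 h2 ⊢
    split_ifs at h2 ⊢ <;> simp_all <;> omega
  · intro heq
    have hmem : ((⟨i, Nat.lt_of_succ_lt h⟩, ⟨i + 1, h⟩) : Fin n × Fin n) ∈
        (Finset.univ.filter fun p : Fin n × Fin n => p.1 < p.2 ∧ w p.1 < w p.2) := by
      simpa using hw
    rw [← heq] at hmem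
    obtain ⟨⟨a, b⟩, hab, he⟩ := Finset.mem_map.1 hmem
    replace hab := (Finset.mem_filter.1 hab).2.1
    simp only [Equiv.coe_toEmbedding, Equiv.prodCongr_apply, Prod.map_apply, Prod.mk.injEq] at he
    have ha : a = ⟨i + 1, h⟩ := by
      rw [← s.symm_apply_eq.2 he.1.symm, hs, simpleSwap]; simp
    have hb : b = ⟨i, Nat.lt_of_succ_lt h⟩ := by
      rw [← s.symm_apply_eq.2 he.2.symm, hs, simpleSwap]; simp
    rw [ha, hb] at hab
    exact absurd hab (by simp)

/-- The `β`-Grothendieck polynomial `𝔊_w`: it is `x_1^{n-1} x_2^{n-2} ⋯ x_{n-1}` for `w = w₀`,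
and `π_i 𝔊_{w s_i}` with `i` the first ascent of `w` otherwise. The theorem
`grothendieck_of_isAscent` shows that every other ascent gives the same polynomial. -/
noncomputable def grothendieck {n : ℕ} (w : Equiv.Perm (Fin n)) : PolyRing n :=
  if hw : w = Fin.revPerm then
    ∏ i : Fin n, MvPolynomial.X i ^ (n - 1 - (i : ℕ))
  else
    isobaric ⟨Nat.find (exists_isAscent hw),
        Nat.lt_of_succ_lt (Nat.find_spec (exists_isAscent hw)).choose⟩
      ⟨Nat.find (exists_isAscent hw) + 1, (Nat.find_spec (exists_isAscent hw)).choose⟩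
      (grothendieck (w * simpleSwap (Nat.find (exists_isAscent hw))
        (Nat.find_spec (exists_isAscent hw)).choose))
termination_by colength w
decreasing_by
  exact colength_mul_simpleSwap_lt w _ _ (Nat.find_spec (exists_isAscent hw)).choose_spec

section WellDefined

open MvPolynomial

variable {n : ℕ}

theorem act_act (u v : Equiv.Perm (Fin n)) (f : PolyRing n) : act u (act v f) = act (u * v) f := by
  simp [act, MvPolynomial.rename_rename, Equiv.Perm.coe_mul]

theorem isobaric_spec (i j : Fin n) (f : PolyRing n) :
    (X i - X j) * isobaric i j f =
      (1 + beta n * X j) * f - (1 + beta n * X i) * act (Equiv.swap i j) f := by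
  rw [isobaric, divDiff_spec]
  simp [act, beta]

theorem act_isobaric_spec (u : Equiv.Perm (Fin n)) (i j : Fin n) (f : PolyRing n) :
    (X (u i) - X (u j)) * act u (isobaric i j f) =
      (1 + beta n * X (u j)) * act u f -
        (1 + beta n * X (u i)) * act (u * Equiv.swap i j) f := by
  have h := congrArg (act u) (isobaric_spec i j f)
  rw [← act_act]
  simpa [act, beta] using h

theorem X_sub_X_ne {i j : Fin n} (h : i ≠ j) : (X i - X j : PolyRing n) ≠ 0 :=
  sub_ne_zero.2 fun he => h (X_injective he)

theorem act_swap_isobaric {i j : Fin n} (h : i ≠ j) (f : PolyRing n) :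
    act (Equiv.swap i j) (isobaric i j f) = isobaric i j f := by
  refine mul_left_cancel₀ (X_sub_X_ne h.symm) ?_
  have h1 := act_isobaric_spec (Equiv.swap i j) i j f
  have h2 := isobaric_spec i j f
  have h3 : act (1 : Equiv.Perm (Fin n)) f = f := by simp [act]
  rw [Equiv.swap_mul_self, h3, Equiv.swap_apply_left, Equiv.swap_apply_right] at h1
  linear_combination h1 + h2

/-- `π_i π_k = π_k π_i` for `|i - k| > 1`. -/
theorem isobaric_comm {i j k l : Fin n} (hij : i ≠ j) (hkl : k ≠ l) (hik : i ≠ k) (hil : i ≠ l)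
    (hjk : j ≠ k) (hjl : j ≠ l) (f : PolyRing n) :
    isobaric i j (isobaric k l f) = isobaric k l (isobaric i j f) := by
  refine mul_left_cancel₀ (X_sub_X_ne hij) (mul_left_cancel₀ (X_sub_X_ne hkl) ?_)
  have hc : Equiv.swap k l * Equiv.swap i j = Equiv.swap i j * Equiv.swap k l :=
    (Equiv.Perm.disjoint_swap_swap (by simp; grind)).commute
  have a1 := isobaric_spec i j (isobaric k l f)
  have a2 := isobaric_spec k l f
  have a3 := act_isobaric_spec (Equiv.swap i j) k l f
  have b1 := isobaric_spec k l (isobaric i j f)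
  have b2 := isobaric_spec i j f
  have b3 := act_isobaric_spec (Equiv.swap k l) i j f
  rw [Equiv.swap_apply_of_ne_of_ne hik.symm hjk.symm,
    Equiv.swap_apply_of_ne_of_ne hil.symm hjl.symm] at a3
  rw [Equiv.swap_apply_of_ne_of_ne hik hil, Equiv.swap_apply_of_ne_of_ne hjk hjl, hc] at b3
  linear_combination (X k - X l) * a1 - (X i - X j) * b1 + (1 + beta n * X j) * a2
    - (1 + beta n * X i) * a3 - (1 + beta n * X l) * b2 + (1 + beta n * X k) * b3

/-- `π_i π_{i+1} π_i = π_{i+1} π_i π_{i+1}`. -/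
theorem isobaric_braid {a b c : Fin n} (hab : a ≠ b) (hbc : b ≠ c) (hac : a ≠ c)
    (f : PolyRing n) :
    isobaric a b (isobaric b c (isobaric a b f)) =
      isobaric b c (isobaric a b (isobaric b c f)) := by
  refine mul_left_cancel₀ (X_sub_X_ne hab) (mul_left_cancel₀ (X_sub_X_ne hbc)
    (mul_left_cancel₀ (X_sub_X_ne hac) ?_))
  set s := Equiv.swap a b with hs
  set t := Equiv.swap b c with ht
  have sa : s a = b := by simp [hs]
  have sb : s b = a := by simp [hs]
  have sc : s c = c := Equiv.swap_apply_of_ne_of_ne hac.symm hbc.symm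
  have ta : t a = a := Equiv.swap_apply_of_ne_of_ne hab hac
  have tb : t b = c := by simp [ht]
  have tc : t c = b := by simp [ht]
  have hbraid : t * s * t = s * t * s := by
    ext x
    simp only [Equiv.Perm.mul_apply]
    by_cases hxa : x = a
    · subst hxa; simp [sa, sc, ta, tb]
    by_cases hxb : x = b
    · subst hxb; simp [sa, sb, sc, ta, tb, tc]
    by_cases hxc : x = c
    · subst hxc; simp [sb, sc, ta, tc]
    have h1 : s x = x := Equiv.swap_apply_of_ne_of_ne hxa hxb
    have h2 : t x = x := Equiv.swap_apply_of_ne_of_ne hxb hxc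
    simp [h1, h2]
  have e1 := isobaric_spec a b f
  have e2 := act_isobaric_spec t a b f
  have e3 := act_isobaric_spec (s * t) a b f
  have e4 := isobaric_spec b c (isobaric a b f)
  have e5 := act_isobaric_spec s b c (isobaric a b f)
  have e6 := isobaric_spec a b (isobaric b c (isobaric a b f))
  have e7 := act_swap_isobaric hab f
  have g1 := isobaric_spec b c f
  have g2 := act_isobaric_spec s b c f
  have g3 := act_isobaric_spec (t * s) b c f
  have g4 := isobaric_spec a b (isobaric b c f)
  have g5 := act_isobaric_spec t a b (isobaric b c f)
  have g6 := isobaric_spec b c (isobaric a b (isobaric b c f))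
  have g7 := act_swap_isobaric hbc f
  simp only [← hs, ← ht, Equiv.Perm.mul_apply, sa, sb, sc, ta, tb, tc, hbraid]
    at e1 e2 e3 e4 e5 e6 e7 g1 g2 g3 g4 g5 g6 g7
  linear_combination (X a - X c) * (X b - X c) * e6 + (X a - X c) * (1 + beta n * X b) * e4
    - (X b - X c) * (1 + beta n * X a) * e5
    - (X b - X c) * (1 + beta n * X a) * (1 + beta n * X c) * e7
    + (1 + beta n * X c) ^ 2 * e1 - (1 + beta n * X b) ^ 2 * e2 + (1 + beta n * X a) ^ 2 * e3
    - ((X a - X b) * (X a - X c) * g6 + (X a - X c) * (1 + beta n * X c) * g4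
    - (X a - X b) * (1 + beta n * X b) * g5
    - (X a - X b) * (1 + beta n * X b) * (1 + beta n * X c) * g7
    + (1 + beta n * X b) * (1 + beta n * X c) * g1
    - (1 + beta n * X c) * (1 + beta n * X a) * g2
    + (1 + beta n * X b) * (1 + beta n * X a) * g3)

theorem grothendieck_of_isAscent_aux (N : ℕ) : ∀ (w : Equiv.Perm (Fin n)), colength w < N →
    ∀ (i : ℕ) (h : i + 1 < n), w ⟨i, Nat.lt_of_succ_lt h⟩ < w ⟨i + 1, h⟩ →
    grothendieck w = isobaric ⟨i, Nat.lt_of_succ_lt h⟩ ⟨i + 1, h⟩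
      (grothendieck (w * simpleSwap i h)) := by
  induction N with
  | zero => intro w hN; exact absurd hN (Nat.not_lt_zero _)
  | succ N ih =>
    intro w hN
    have key : ∀ (i k : ℕ) (hi : i + 1 < n) (hk : k + 1 < n), i < k →
        w ⟨i, Nat.lt_of_succ_lt hi⟩ < w ⟨i + 1, hi⟩ →
        w ⟨k, Nat.lt_of_succ_lt hk⟩ < w ⟨k + 1, hk⟩ →
        isobaric ⟨i, Nat.lt_of_succ_lt hi⟩ ⟨i + 1, hi⟩ (grothendieck (w * simpleSwap i hi)) =
        isobaric ⟨k, Nat.lt_of_succ_lt hk⟩ ⟨k + 1, hk⟩ (grothendieck (w * simpleSwap k hk)) := by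
      intro i k hi hk hik wi wk
      have ci := colength_mul_simpleSwap_lt w i hi wi
      have ck := colength_mul_simpleSwap_lt w k hk wk
      rcases Nat.lt_or_ge (i + 1) k with hlt | hge
      · have ai : (w * simpleSwap k hk) ⟨i, Nat.lt_of_succ_lt hi⟩ <
            (w * simpleSwap k hk) ⟨i + 1, hi⟩ := by
          rw [Equiv.Perm.mul_apply, Equiv.Perm.mul_apply, simpleSwap,
            Equiv.swap_apply_of_ne_of_ne (by simp; omega) (by simp; omega),
            Equiv.swap_apply_of_ne_of_ne (by simp; omega) (by simp; omega)]
          exact wi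
        have ak : (w * simpleSwap i hi) ⟨k, Nat.lt_of_succ_lt hk⟩ <
            (w * simpleSwap i hi) ⟨k + 1, hk⟩ := by
          rw [Equiv.Perm.mul_apply, Equiv.Perm.mul_apply, simpleSwap,
            Equiv.swap_apply_of_ne_of_ne (by simp; omega) (by simp; omega),
            Equiv.swap_apply_of_ne_of_ne (by simp; omega) (by simp; omega)]
          exact wk
        have hc : simpleSwap i hi * simpleSwap k hk = simpleSwap k hk * simpleSwap i hi :=
          (Equiv.Perm.disjoint_swap_swap (by simp; omega)).commute
        rw [ih _ (by omega) k hk ak, ih _ (by omega) i hi ai, mul_assoc, mul_assoc, hc]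
        exact isobaric_comm (by simp) (by simp) (by simp; omega) (by simp; omega)
          (by simp; omega) (by simp; omega) _
      · obtain rfl : k = i + 1 := by omega
        set A : Fin n := ⟨i, Nat.lt_of_succ_lt hi⟩ with hA
        set B : Fin n := ⟨i + 1, hi⟩ with hB
        set C : Fin n := ⟨i + 1 + 1, hk⟩ with hC
        have hab : A ≠ B := by simp [hA, hB]
        have hbc : B ≠ C := by simp [hB, hC]
        have hac : A ≠ C := by simp [hA, hC]; omega
        set s := simpleSwap i hi with hs
        set t := simpleSwap (i + 1) hk with ht
        have sa : s A = B := by simp [hs, simpleSwap, hA, hB]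
        have sb : s B = A := by simp [hs, simpleSwap, hA, hB]
        have sc : s C = C := Equiv.swap_apply_of_ne_of_ne hac.symm hbc.symm
        have ta : t A = A := Equiv.swap_apply_of_ne_of_ne hab hac
        have tb : t B = C := by simp [ht, simpleSwap, hC, hB]
        have tc : t C = B := by simp [ht, simpleSwap, hC, hB]
        have hbraid : w * s * t * s = w * t * s * t := by
          ext x
          simp only [Equiv.Perm.mul_apply]
          by_cases hxa : x = A
          · rw [hxa]; simp [sa, sc, ta, tb]
          by_cases hxb : x = B
          · rw [hxb]; simp [sa, sb, sc, ta, tb, tc]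
          by_cases hxc : x = C
          · rw [hxc]; simp [sb, sc, ta, tc]
          have h1 : s x = x := Equiv.swap_apply_of_ne_of_ne hxa hxb
          have h2 : t x = x := Equiv.swap_apply_of_ne_of_ne hxb hxc
          simp [h1, h2]
        have wt := wi.trans wk
        have p1 : (w * s) B < (w * s) C := by
          simpa only [Equiv.Perm.mul_apply, sb, sc] using wt
        have p2 : (w * s * t) A < (w * s * t) B := by
          simpa only [Equiv.Perm.mul_apply, sa, ta, tb, sc] using wk
        have q1 : (w * t) A < (w * t) B := by
          simpa only [Equiv.Perm.mul_apply, ta, tb] using wt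
        have q2 : (w * t * s) B < (w * t * s) C := by
          simpa only [Equiv.Perm.mul_apply, sb, sc, ta, tc] using wi
        have d1 := colength_mul_simpleSwap_lt (w * s) (i + 1) hk p1
        have d2 := colength_mul_simpleSwap_lt (w * t) i hi q1
        rw [← ht] at d1
        rw [← hs] at d2
        rw [ih (w * s) (by omega) (i + 1) hk p1, ih (w * s * t) (by omega) i hi p2,
          ih (w * t) (by omega) i hi q1, ih (w * t * s) (by omega) (i + 1) hk q2,
          ← hs, ← ht, hbraid]
        exact isobaric_braid hab hbc hac _
    intro i hi wi
    have hw : w ≠ Fin.revPerm := by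
      rintro rfl
      simp [Fin.lt_def] at wi
      omega
    rw [grothendieck, dif_neg hw]
    generalize_proofs h1 h2 h3
    obtain ⟨_, wk⟩ := Nat.find_spec (exists_isAscent hw)
    rcases lt_trichotomy i (Nat.find (exists_isAscent hw)) with hlt | heq | hgt
    · exact (key i _ hi h3 hlt wi wk).symm
    · subst heq; rfl
    · exact key _ i h3 hi hgt wk wi

/-- The recursion `𝔊_w = π_i 𝔊_{w s_i}` holds for every ascent `i` of `w`. -/
theorem grothendieck_of_isAscent (w : Equiv.Perm (Fin n)) (i : ℕ) (h : i + 1 < n)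
    (hw : w ⟨i, Nat.lt_of_succ_lt h⟩ < w ⟨i + 1, h⟩) :
    grothendieck w = isobaric ⟨i, Nat.lt_of_succ_lt h⟩ ⟨i + 1, h⟩
      (grothendieck (w * simpleSwap i h)) :=
  grothendieck_of_isAscent_aux _ w (Nat.lt_succ_self _) i h hw

end WellDefined

/-- The principal specialization `Υ_w(β) = 𝔊_w(1, …, 1) ∈ ℤ[β]`. -/
noncomputable def upsilon {n : ℕ} (w : Equiv.Perm (Fin n)) : Polynomial ℤ :=
  MvPolynomial.eval (fun _ => 1) (grothendieck w)

/-- `p_v(w)`: the number of choices `e` of positions `i_1 < ⋯ < i_m` such that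
`w(i_1), …, w(i_m)` has the same relative order as `v(1), …, v(m)`. -/
noncomputable def patternCount {m n : ℕ} (v : Equiv.Perm (Fin m)) (w : Equiv.Perm (Fin n)) : ℕ :=
  Nat.card {e : Fin m ↪o Fin n // ∀ a b : Fin m, v a < v b ↔ w (e a) < w (e b)}

/-- The polynomials `c_w(β) ∈ ℤ[β]`: `c_∅ = 1`, and for `w ∈ S_n` with `n ≥ 1`,
`c_w(β) = Υ_w(β) - ∑ c_v(β) p_v(w)`, the sum over all `v ∈ S_m` with `0 ≤ m < n`. -/
noncomputable def patternCoeff : {n : ℕ} → Equiv.Perm (Fin n) → Polynomial ℤ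
  | 0, _ => 1
  | n + 1, w => upsilon w -
      ∑ m : Fin (n + 1), ∑ v : Equiv.Perm (Fin m), patternCoeff v * (patternCount v w : Polynomial ℤ)
termination_by n => n
decreasing_by exact m.isLt

end GrothendieckSpecialization

/-! The heart of the matter is the symmetry `Υ_w = Υ_{w⁻¹}` (`upsilon_inv`). Pattern counts satisfy
`p_{v⁻¹}(w⁻¹) = p_v(w)` (`patternCount_inv`), because an occurrence read by its values is an
occurrence of the inverse pattern. Induction on `n` then turns the recursion for `c_w` into the one
for `c_{w⁻¹}`.

The symmetry comes from the degenerate Hecke algebra, with `u_i² = β u_i` and the braid relations.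
There `𝔊_w` is the coefficient of `w` in a triangular product of factors `1 + x_r u_j`
(`grothendieck_eq_fkCoeff`). Two facts identify it: a Yang-Baxter exchange gives the recursion by
`π_i` (`HeckeRel.heckeFactor_mul_fkProd`, `fkCoeff_of_isAscent`), and a length count gives the
monomial at `w₀` (`fkProd_revPerm`).

At `x = 1` all factors with the same `j` agree, and commuting distant factors turns the product into
its own reversal (`triProd_eq_triProdRev`). The anti-automorphism `w ↦ w⁻¹` of the algebra also
reverses products, so the coefficients of `w` and `w⁻¹` coincide (`fkProd_one_inv`).

The algebra appears only through its actions on coefficient functions `Perm (Fin n) → R`. Its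
elements are operators applied to `deltaOne`, and the anti-automorphism becomes the exchange of the
right and left actions. -/

namespace GrothendieckSpecialization

/-! ### Triangular products and their reversal -/

section Products

variable {A B : Type*} [Monoid A] [Monoid B]

/-- `a_i a_{i+1} ⋯ a_{i+k-1}`. -/
def ascProd (a : ℕ → A) (i : ℕ) : ℕ → A
  | 0 => 1
  | k + 1 => a i * ascProd a (i + 1) k

/-- `a_{i+k-1} ⋯ a_{i+1} a_i`. -/
def descProd (a : ℕ → A) (i : ℕ) : ℕ → A
  | 0 => 1
  | k + 1 => descProd a (i + 1) k * a i

/-- The triangular product `⋯ (a_{i+1,i+1} ⋯ a_{i+1,i+k-2}) (a_{i,i} ⋯ a_{i,i+k-2})`. -/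
def triProd (a : ℕ → ℕ → A) (i : ℕ) : ℕ → A
  | 0 => 1
  | k + 1 => triProd a (i + 1) k * ascProd (a i) i k

/-- The triangular product `(a_{i+k-2} ⋯ a_i) (a_{i+k-2} ⋯ a_{i+1}) ⋯`. -/
def triProdRev (a : ℕ → A) (i : ℕ) : ℕ → A
  | 0 => 1
  | k + 1 => descProd a i k * triProdRev a (i + 1) k

theorem commute_ascProd {c : A} {a : ℕ → A} {i : ℕ} (k : ℕ) (h : ∀ j, i ≤ j → Commute c (a j)) :
    Commute c (ascProd a i k) := by
  induction k generalizing i with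
  | zero => exact Commute.one_right c
  | succ k ih => exact (h i le_rfl).mul_right (ih fun j hj => h j (by omega))

theorem commute_descProd {c : A} {a : ℕ → A} {i : ℕ} (k : ℕ) (h : ∀ j, i ≤ j → Commute c (a j)) :
    Commute c (descProd a i k) := by
  induction k generalizing i with
  | zero => exact Commute.one_right c
  | succ k ih => exact (ih fun j hj => h j (by omega)).mul_right (h i le_rfl)

theorem commute_triProd {c : A} {a : ℕ → ℕ → A} {i : ℕ} (k : ℕ)
    (h : ∀ r j, i ≤ j → Commute c (a r j)) : Commute c (triProd a i k) := by
  induction k generalizing i with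
  | zero => exact Commute.one_right c
  | succ k ih =>
    exact (ih fun r j hj => h r j (by omega)).mul_right (commute_ascProd k (h i))

theorem map_ascProd (φ : A →* B) (a : ℕ → A) (i k : ℕ) :
    φ (ascProd a i k) = ascProd (fun j => φ (a j)) i k := by
  induction k generalizing i with
  | zero => exact map_one φ
  | succ k ih => simp only [ascProd, map_mul, ih]

theorem map_triProd (φ : A →* B) (a : ℕ → ℕ → A) (i k : ℕ) :
    φ (triProd a i k) = triProd (fun r j => φ (a r j)) i k := by
  induction k generalizing i with
  | zero => exact map_one φ
  | succ k ih => simp only [triProd, map_mul, ih, map_ascProd]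

/-- The triangular product does not change when it is read backwards, if distant factors
commute. -/
theorem triProd_eq_triProdRev {a : ℕ → A} (hc : ∀ i j, i + 1 < j → Commute (a i) (a j)) (i k : ℕ) :
    triProd (fun _ => a) i k = triProdRev a i k := by
  induction k using Nat.strong_induction_on generalizing i with
  | _ k ih =>
    match k with
    | 0 => rfl
    | 1 => simp [triProd, triProdRev, ascProd, descProd]
    | k + 2 =>
      -- All factors here have index at least `i + 2`, so `a i` passes through them. The remaining
      -- block joins with `ascProd a (i + 1) k` into a triangle based at `i + 1`.
      have h1 : Commute (a i) (triProdRev a (i + 2) k) := by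
        rw [← ih k (by omega)]
        exact commute_triProd k fun _ j hj => hc i j (by omega)
      have h2 := ih (k + 1) (by omega) (i + 1)
      have h3 : triProdRev a (i + 2) k * ascProd a (i + 1) k = triProdRev a (i + 1) (k + 1) := by
        rw [← h2, ← ih k (by omega)]; rfl
      calc triProd (fun _ => a) i (k + 2)
          = triProd (fun _ => a) (i + 1) (k + 1) * (a i * ascProd a (i + 1) k) := rfl
        _ = descProd a (i + 1) k * (triProdRev a (i + 2) k * a i) * ascProd a (i + 1) k := by
            rw [h2]; simp only [triProdRev, mul_assoc]
        _ = descProd a (i + 1) k * a i * (triProdRev a (i + 2) k * ascProd a (i + 1) k) := by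
            rw [← h1.eq]; simp only [mul_assoc]
        _ = triProdRev a i (k + 2) := by rw [h3]; rfl

end Products

/-! ### Exchanging commuting left and right actions -/

section Reversal

variable {R M : Type*} [CommRing R] [AddCommGroup M] [Module R M]

/-- The factor next to `d` may be changed from `a` to `b` and then moved outwards past the remaining
`a`'s. Repeating this replaces every factor and reverses their order. -/
theorem ascProd_apply_eq_descProd_apply {a b : ℕ → Module.End R M} {d : M}
    (hc : ∀ i j, Commute (a i) (b j)) (hd : ∀ i, a i d = b i d) (i k : ℕ) :
    ascProd a i k d = descProd b i k d := by
  induction k generalizing i with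
  | zero => rfl
  | succ k ih =>
    rw [ascProd, Module.End.mul_apply, ih, ← Module.End.mul_apply,
      (commute_descProd k fun j _ => hc i j).eq, Module.End.mul_apply, hd]
    rfl

theorem triProd_apply_eq_triProdRev_apply {a b : ℕ → Module.End R M} {d : M}
    (hc : ∀ i j, Commute (a i) (b j)) (hd : ∀ i, a i d = b i d) (i k : ℕ) :
    triProd (fun _ => a) i k d = triProdRev b i k d := by
  induction k generalizing i with
  | zero => rfl
  | succ k ih =>
    have h : Commute (triProd (fun _ => a) (i + 1) k) (descProd b i k) :=
      commute_descProd k fun j _ => (commute_triProd k fun _ l _ => (hc l j).symm).symm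
    rw [triProd, Module.End.mul_apply, ascProd_apply_eq_descProd_apply hc hd,
      ← Module.End.mul_apply, h.eq, Module.End.mul_apply, ih]
    rfl

end Reversal

/-! ### Degenerate Hecke relations and the Yang-Baxter exchange -/

section Hecke

variable {R A : Type*} [CommRing R] [Ring A] [Algebra R A]

/-- The relations of the generators of the degenerate Hecke algebra. -/
structure HeckeRel (β : R) (u : ℕ → A) : Prop where
  sq : ∀ i, u i * u i = β • u i
  comm : ∀ i j, i + 1 < j → Commute (u i) (u j)
  braid : ∀ i, u i * u (i + 1) * u i = u (i + 1) * u i * u (i + 1)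

/-- The factors `1 + x u_j`. -/
def heckeFactor (u : ℕ → A) (x : R) (j : ℕ) : A := 1 + x • u j

theorem HeckeRel.commute_heckeFactor {β : R} {u : ℕ → A} (hu : HeckeRel β u) (x y : R) {i j : ℕ}
    (hij : i + 1 < j) : Commute (heckeFactor u x i) (heckeFactor u y j) := by
  have h := hu.comm i j hij
  exact (Commute.one_left _).add_left
    ((Commute.one_right _).add_right ((h.smul_right y).smul_left x))

theorem HeckeRel.heckeFactor_comm {β : R} {u : ℕ → A} (_ : HeckeRel β u) (x y : R) (i : ℕ) :
    Commute (heckeFactor u x i) (heckeFactor u y i) :=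
  (Commute.one_left _).add_left
    ((Commute.one_right _).add_right (((Commute.refl _).smul_right y).smul_left x))

/-- The element `T(x, y)`, symmetric in `x` and `y`, with
`(1 + x u_i) (1 + x u_{i+1}) (1 + y u_i) = T(x, y) (1 + x u_{i+1})`. -/
def yangBaxterFactor (β : R) (u : ℕ → A) (x y : R) (i : ℕ) : A :=
  1 + (x + y + β * x * y) • u i + (x * y) • (u (i + 1) * u i - u i * u (i + 1))

theorem yangBaxterFactor_symm (β : R) (u : ℕ → A) (x y : R) (i : ℕ) :
    yangBaxterFactor β u x y i = yangBaxterFactor β u y x i := by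
  unfold yangBaxterFactor
  module

theorem HeckeRel.heckeFactor_mul {β : R} {u : ℕ → A} (hu : HeckeRel β u) (x y : R) (i : ℕ) :
    heckeFactor u x i * heckeFactor u x (i + 1) * heckeFactor u y i =
      yangBaxterFactor β u x y i * heckeFactor u x (i + 1) := by
  have h1 := hu.sq i
  have h2 : u i * u (i + 1) * u (i + 1) = β • (u i * u (i + 1)) := by
    rw [mul_assoc, hu.sq, mul_smul_comm]
  have h3 := hu.braid i
  simp only [heckeFactor, yangBaxterFactor, mul_add, add_mul, mul_one, one_mul, sub_mul,
    smul_mul_assoc, mul_smul_comm, h1, h2, h3]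
  module

/-- `h_i(x) h_i(y)` is symmetric in `x` and `y`. -/
theorem HeckeRel.commute_ascProd {β : R} {u : ℕ → A} (hu : HeckeRel β u) (x y : R) (i k : ℕ) :
    Commute (ascProd (heckeFactor u x) i k) (ascProd (heckeFactor u y) i k) := by
  -- Peeling off `yangBaxterFactor`, which is symmetric in `x` and `y`, leaves the same product
  -- based at `i + 1`, so symmetry follows by induction.
  have key : ∀ (x y : R) (i k : ℕ),
      ascProd (heckeFactor u x) i (k + 2) * ascProd (heckeFactor u y) i (k + 2) =
        yangBaxterFactor β u x y i * (ascProd (heckeFactor u x) (i + 1) (k + 1) *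
          ascProd (heckeFactor u y) (i + 1) (k + 1)) := by
    intro x y i k
    have hc : Commute (heckeFactor u y i) (ascProd (heckeFactor u x) (i + 2) k) :=
      GrothendieckSpecialization.commute_ascProd k fun j hj =>
        hu.commute_heckeFactor y x (by omega)
    have hm := hu.heckeFactor_mul x y i
    simp only [ascProd]
    calc _ = heckeFactor u x i * heckeFactor u x (i + 1) *
          (ascProd (heckeFactor u x) (i + 2) k * heckeFactor u y i) *
          (heckeFactor u y (i + 1) * ascProd (heckeFactor u y) (i + 2) k) := by
            simp only [mul_assoc]
      _ = (heckeFactor u x i * heckeFactor u x (i + 1) * heckeFactor u y i) *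
          (ascProd (heckeFactor u x) (i + 2) k *
          (heckeFactor u y (i + 1) * ascProd (heckeFactor u y) (i + 2) k)) := by
            rw [← hc.eq]; simp only [mul_assoc]
      _ = _ := by rw [hm]; simp only [mul_assoc]
  induction k generalizing i with
  | zero => exact Commute.one_left _
  | succ k ih =>
    cases k with
    | zero => simpa [ascProd] using hu.heckeFactor_comm x y i
    | succ k =>
      rw [Commute, SemiconjBy, key, key, (ih (i + 1)).eq, yangBaxterFactor_symm]

/-- The Fomin-Kirillov product. -/
def fkProd (u : ℕ → A) (x : ℕ → R) (i k : ℕ) : A := triProd (fun r => heckeFactor u (x r)) i k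

theorem fkProd_succ (u : ℕ → A) (x : ℕ → R) (i k : ℕ) :
    fkProd u x i (k + 1) = fkProd u x (i + 1) k * ascProd (heckeFactor u (x i)) i k := rfl

theorem fkProd_congr (u : ℕ → A) {x y : ℕ → R} (i k : ℕ) (h : ∀ j, i ≤ j → x j = y j) :
    fkProd u x i k = fkProd u y i k := by
  induction k generalizing i with
  | zero => rfl
  | succ k ih => rw [fkProd_succ, fkProd_succ, ih _ fun j hj => h j (by omega), h i le_rfl]

/-- With `h_i(x)` the row of factors starting at index `i`, the extra factor `1 + x_{i+1} u_i`
commutes past the rows above and completes row `i + 1` to `h_i(x_{i+1})`. The product `h_i(x_{i+1})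
h_i(x_i)` is symmetric in the two variables. Rows below `i` do not involve `x_i` or `x_{i+1}`.
Comparing coefficients in this identity yields the `π_i` recursion. -/
theorem HeckeRel.heckeFactor_mul_fkProd {β : R} {u : ℕ → A} (hu : HeckeRel β u) (x : ℕ → R)
    {i j k : ℕ} (hji : j ≤ i) (hik : i + 1 < j + k) :
    heckeFactor u (x (i + 1)) i * fkProd u x j k =
      heckeFactor u (x i) i * fkProd u (x ∘ Equiv.swap i (i + 1)) j k := by
  obtain ⟨d, rfl⟩ := Nat.exists_eq_add_of_le hji
  induction d generalizing j k with
  | zero =>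
    obtain ⟨k, rfl⟩ : ∃ k', k = k' + 2 := ⟨k - 2, by omega⟩
    simp only [Nat.add_zero]
    have h : ∀ y : ℕ → R, heckeFactor u (y (j + 1)) j * fkProd u y j (k + 2) =
        fkProd u y (j + 2) k * (ascProd (heckeFactor u (y (j + 1))) j (k + 1) *
          ascProd (heckeFactor u (y j)) j (k + 1)) := by
      intro y
      have hc : Commute (heckeFactor u (y (j + 1)) j) (fkProd u y (j + 2) k) :=
        commute_triProd k fun r l hl => hu.commute_heckeFactor _ _ (by omega)
      rw [fkProd_succ, fkProd_succ, ← mul_assoc, ← mul_assoc, hc.eq]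
      simp only [ascProd, mul_assoc]
    have h2 := h (x ∘ Equiv.swap j (j + 1))
    simp only [Function.comp_apply, Equiv.swap_apply_left, Equiv.swap_apply_right] at h2
    rw [h, h2, (hu.commute_ascProd _ _ j (k + 1)).eq,
      fkProd_congr u (x := x) (y := x ∘ Equiv.swap j (j + 1)) (j + 2) k]
    intro l hl
    simp [Equiv.swap_apply_of_ne_of_ne (show l ≠ j by omega) (show l ≠ j + 1 by omega)]
  | succ d ih =>
    obtain ⟨k, rfl⟩ : ∃ k', k = k' + 1 := ⟨k - 1, by omega⟩
    have h := ih (j := j + 1) (k := k) (by omega) (by omega)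
    rw [show j + 1 + d = j + (d + 1) by omega] at h
    rw [fkProd_succ, fkProd_succ, ← mul_assoc, h, mul_assoc, Function.comp_apply,
      Equiv.swap_apply_of_ne_of_ne (show j ≠ j + (d + 1) by omega)
      (show j ≠ j + (d + 1) + 1 by omega)]

end Hecke

/-! ### Right and left Hecke actions on functions on the symmetric group -/

section Operators

variable {n : ℕ} {R : Type*} [CommRing R]

/-- `w(i) > w(i+1)`. -/
def IsDescent (w : Equiv.Perm (Fin n)) (i : ℕ) : Prop :=
  ∃ h : i + 1 < n, w ⟨i + 1, h⟩ < w ⟨i, Nat.lt_of_succ_lt h⟩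

instance (w : Equiv.Perm (Fin n)) (i : ℕ) : Decidable (IsDescent w i) :=
  inferInstanceAs (Decidable (∃ h : i + 1 < n, w ⟨i + 1, h⟩ < w ⟨i, Nat.lt_of_succ_lt h⟩))

variable (n) in
/-- The simple transposition `s_i`, or `1` if `i + 1` is not a position. -/
def simpleRefl (i : ℕ) : Equiv.Perm (Fin n) := if h : i + 1 < n then simpleSwap i h else 1

theorem simpleRefl_eq {i : ℕ} (h : i + 1 < n) : simpleRefl n i = simpleSwap i h := dif_pos h

theorem simpleSwap_apply_left {i : ℕ} (h : i + 1 < n) :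
    simpleSwap i h ⟨i, Nat.lt_of_succ_lt h⟩ = ⟨i + 1, h⟩ := Equiv.swap_apply_left _ _

theorem simpleSwap_apply_right {i : ℕ} (h : i + 1 < n) :
    simpleSwap i h ⟨i + 1, h⟩ = ⟨i, Nat.lt_of_succ_lt h⟩ := Equiv.swap_apply_right _ _

theorem simpleSwap_apply_of_ne {i : ℕ} (h : i + 1 < n) {a : Fin n} (h1 : (a : ℕ) ≠ i)
    (h2 : (a : ℕ) ≠ i + 1) : simpleSwap i h a = a :=
  Equiv.swap_apply_of_ne_of_ne (fun e => h1 (congrArg Fin.val e)) fun e => h2 (congrArg Fin.val e)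

theorem simpleRefl_mul_self (i : ℕ) : simpleRefl n i * simpleRefl n i = 1 := by
  unfold simpleRefl
  split_ifs with h
  · exact Equiv.swap_mul_self _ _
  · rfl

theorem simpleRefl_inv (i : ℕ) : (simpleRefl n i)⁻¹ = simpleRefl n i :=
  inv_eq_of_mul_eq_one_left (simpleRefl_mul_self i)

theorem mul_simpleRefl_cancel (w : Equiv.Perm (Fin n)) (i : ℕ) :
    w * simpleRefl n i * simpleRefl n i = w := by
  rw [mul_assoc, simpleRefl_mul_self, mul_one]

theorem isDescent_mul_simpleRefl {w : Equiv.Perm (Fin n)} {i : ℕ} (h : i + 1 < n) :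
    IsDescent (w * simpleRefl n i) i ↔ ¬ IsDescent w i := by
  have hne : w ⟨i, Nat.lt_of_succ_lt h⟩ ≠ w ⟨i + 1, h⟩ := fun e => by
    have := w.injective e
    simp at this
  simp only [IsDescent, h, exists_true_left, simpleRefl_eq h, Equiv.Perm.mul_apply,
    simpleSwap_apply_left, simpleSwap_apply_right, not_lt]
  exact ⟨le_of_lt, fun h => lt_of_le_of_ne h hne⟩

/-- The right action of the generator `u_i` on coefficients. -/
def heckeOp (β : R) (i : ℕ) : Module.End R (Equiv.Perm (Fin n) → R) where
  toFun f w := if IsDescent w i then f (w * simpleRefl n i) + β * f w else 0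
  map_add' f g := by
    funext w
    simp only [Pi.add_apply]
    split_ifs <;> ring
  map_smul' c f := by
    funext w
    simp only [Pi.smul_apply, smul_eq_mul, RingHom.id_apply]
    split_ifs <;> ring

theorem heckeOp_apply (β : R) (i : ℕ) (f : Equiv.Perm (Fin n) → R) (w : Equiv.Perm (Fin n)) :
    heckeOp β i f w = if IsDescent w i then f (w * simpleRefl n i) + β * f w else 0 := rfl

theorem heckeOp_sq (β : R) (i : ℕ) :
    (heckeOp β i * heckeOp β i : Module.End R (Equiv.Perm (Fin n) → R)) = β • heckeOp β i := by
  refine LinearMap.ext fun f => funext fun w => ?_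
  simp only [Module.End.mul_apply, LinearMap.smul_apply, Pi.smul_apply, smul_eq_mul, heckeOp_apply]
  by_cases h : IsDescent w i
  · have h2 := (isDescent_mul_simpleRefl (w := w) h.choose).not_left.2 h
    simp [h, h2]
  · simp [h]

theorem isDescent_mul_simpleRefl_of_lt {w : Equiv.Perm (Fin n)} {i j : ℕ} (hij : i + 1 < j) :
    (IsDescent (w * simpleRefl n i) j ↔ IsDescent w j) ∧
      (IsDescent (w * simpleRefl n j) i ↔ IsDescent w i) := by
  constructor
  · refine exists_congr fun h => ?_
    rw [simpleRefl_eq (show i + 1 < n by omega), Equiv.Perm.mul_apply, Equiv.Perm.mul_apply,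
      simpleSwap_apply_of_ne _ (by simp; omega) (by simp; omega),
      simpleSwap_apply_of_ne _ (by simp; omega) (by simp; omega)]
  · refine exists_congr fun h => ?_
    unfold simpleRefl
    split_ifs with h'
    · rw [Equiv.Perm.mul_apply, Equiv.Perm.mul_apply,
        simpleSwap_apply_of_ne _ (by simp; omega) (by simp; omega),
        simpleSwap_apply_of_ne _ (by simp; omega) (by simp; omega)]
    · rfl

theorem simpleRefl_comm {i j : ℕ} (hij : i + 1 < j) :
    simpleRefl n i * simpleRefl n j = simpleRefl n j * simpleRefl n i := by
  unfold simpleRefl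
  split_ifs with h1 h2
  · exact (Equiv.Perm.disjoint_swap_swap (by simp; omega)).commute
  all_goals simp

theorem heckeOp_comm (β : R) {i j : ℕ} (hij : i + 1 < j) :
    Commute (heckeOp β i : Module.End R (Equiv.Perm (Fin n) → R)) (heckeOp β j) := by
  refine LinearMap.ext fun f => funext fun w => ?_
  have h := isDescent_mul_simpleRefl_of_lt (w := w) hij
  simp only [Module.End.mul_apply, heckeOp_apply, h.1, h.2, mul_assoc, simpleRefl_comm hij]
  split_ifs <;> ring

theorem heckeOp_of_not_lt (β : R) {i : ℕ} (h : ¬ i + 1 < n) :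
    (heckeOp β i : Module.End R (Equiv.Perm (Fin n) → R)) = 0 := by
  refine LinearMap.ext fun f => funext fun w => ?_
  rw [heckeOp_apply, if_neg fun hd => h hd.choose]
  rfl

theorem heckeOp_braid (β : R) (i : ℕ) :
    (heckeOp β i * heckeOp β (i + 1) * heckeOp β i : Module.End R (Equiv.Perm (Fin n) → R)) =
      heckeOp β (i + 1) * heckeOp β i * heckeOp β (i + 1) := by
  by_cases hk : i + 1 + 1 < n
  swap
  · simp [heckeOp_of_not_lt β hk]
  have hi : i + 1 < n := by omega
  refine LinearMap.ext fun f => funext fun w => ?_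
  set A : Fin n := ⟨i, Nat.lt_of_succ_lt hi⟩ with hA
  set B : Fin n := ⟨i + 1, hi⟩ with hB
  set C : Fin n := ⟨i + 1 + 1, hk⟩ with hC
  have d1 : ∀ v : Equiv.Perm (Fin n), IsDescent v i ↔ v B < v A := fun v => by
    simp [IsDescent, hi, hA, hB]
  have d2 : ∀ v : Equiv.Perm (Fin n), IsDescent v (i + 1) ↔ v C < v B := fun v => by
    simp [IsDescent, hk, hC, hB]
  set s := simpleRefl n i with hs
  set t := simpleRefl n (i + 1) with ht
  have hss : ∀ v : Equiv.Perm (Fin n), v * s * s = v := fun v => mul_simpleRefl_cancel v i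
  have htt : ∀ v : Equiv.Perm (Fin n), v * t * t = v := fun v => mul_simpleRefl_cancel v (i + 1)
  have sa : s A = B := by rw [hs, simpleRefl_eq hi]; exact simpleSwap_apply_left hi
  have sb : s B = A := by rw [hs, simpleRefl_eq hi]; exact simpleSwap_apply_right hi
  have sc : s C = C := by
    rw [hs, simpleRefl_eq hi]; exact simpleSwap_apply_of_ne hi (by simp [hC]; omega) (by simp [hC])
  have ta : t A = A := by
    rw [ht, simpleRefl_eq hk]; exact simpleSwap_apply_of_ne hk (by simp [hA]) (by simp [hA]; omega)
  have tb : t B = C := by rw [ht, simpleRefl_eq hk]; exact simpleSwap_apply_left hk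
  have tc : t C = B := by rw [ht, simpleRefl_eq hk]; exact simpleSwap_apply_right hk
  have hbraid : w * s * t * s = w * t * s * t := by
    ext x
    simp only [Equiv.Perm.mul_apply]
    by_cases hxa : x = A
    · rw [hxa]; simp [sa, sc, ta, tb]
    by_cases hxb : x = B
    · rw [hxb]; simp [sa, sb, sc, ta, tb, tc]
    by_cases hxc : x = C
    · rw [hxc]; simp [sb, sc, ta, tc]
    have h1 : s x = x := by
      rw [hs, simpleRefl_eq hi]; exact Equiv.swap_apply_of_ne_of_ne hxa hxb
    have h2 : t x = x := by
      rw [ht, simpleRefl_eq hk]; exact Equiv.swap_apply_of_ne_of_ne hxb hxc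
    simp [h1, h2]
  have nab : w A ≠ w B := fun e => by simpa [hA, hB] using w.injective e
  have nbc : w B ≠ w C := fun e => by simpa [hC, hB] using w.injective e
  have nac : w A ≠ w C := fun e => by
    have := w.injective e
    simp [hA, hC] at this
    omega
  simp only [Module.End.mul_apply, heckeOp_apply, d1, d2, ← hs, ← ht, hss, htt, hbraid,
    Equiv.Perm.mul_apply, sa, sb, sc, ta, tb, tc]
  -- Only the relative order of the three entries at `A`, `B`, `C` matters. Two of the eight sign
  -- patterns contradict transitivity, and the other six are checked directly.
  rcases lt_or_gt_of_ne nab with h1 | h1 <;> rcases lt_or_gt_of_ne nbc with h2 | h2 <;>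
    rcases lt_or_gt_of_ne nac with h3 | h3 <;>
    first
    | exact absurd (h1.trans h2) h3.asymm
    | exact absurd (h2.trans h1) h3.asymm
    | simp only [h1, h2, h3, h1.not_gt, h2.not_gt, h3.not_gt, if_true, if_false] <;> ring

theorem heckeOp_heckeRel (β : R) :
    HeckeRel β (heckeOp β : ℕ → Module.End R (Equiv.Perm (Fin n) → R)) :=
  ⟨heckeOp_sq β, fun _ _ => heckeOp_comm β, heckeOp_braid β⟩

variable (n R) in
/-- The coefficients of the identity permutation. -/
def deltaOne : Equiv.Perm (Fin n) → R := fun w => if w = 1 then 1 else 0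

/-- Precomposition with `w ↦ w⁻¹`. -/
def invEquiv : (Equiv.Perm (Fin n) → R) ≃ₗ[R] (Equiv.Perm (Fin n) → R) :=
  LinearEquiv.funCongrLeft R R (Equiv.inv _)

theorem invEquiv_apply (f : Equiv.Perm (Fin n) → R) (w : Equiv.Perm (Fin n)) :
    invEquiv f w = f w⁻¹ := rfl

/-- The left action of the generator `u_i` on coefficients. -/
def heckeOpLeft (β : R) (i : ℕ) : Module.End R (Equiv.Perm (Fin n) → R) :=
  invEquiv.conjRingEquiv (heckeOp β i)

theorem conj_invEquiv_apply (a : Module.End R (Equiv.Perm (Fin n) → R))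
    (f : Equiv.Perm (Fin n) → R) (w : Equiv.Perm (Fin n)) :
    invEquiv.conjRingEquiv a f w = a (invEquiv f) w⁻¹ := rfl

theorem heckeOpLeft_apply (β : R) (i : ℕ) (f : Equiv.Perm (Fin n) → R) (w : Equiv.Perm (Fin n)) :
    heckeOpLeft β i f w =
      if IsDescent w⁻¹ i then f (simpleRefl n i * w) + β * f w else 0 := by
  rw [heckeOpLeft, conj_invEquiv_apply, heckeOp_apply, invEquiv_apply, invEquiv_apply, mul_inv_rev,
    inv_inv, simpleRefl_inv]

/-- The values `i` and `i + 1` are adjacent, so exchanging them affects no comparison other than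
their own. -/
theorem simpleSwap_lt_iff {i : ℕ} (h : i + 1 < n) {p q : Fin n}
    (h1 : ¬ ((p : ℕ) = i ∧ (q : ℕ) = i + 1)) (h2 : ¬ ((p : ℕ) = i + 1 ∧ (q : ℕ) = i)) :
    simpleSwap i h p < simpleSwap i h q ↔ p < q := by
  unfold simpleSwap
  simp only [Equiv.swap_apply_def, Fin.ext_iff, Fin.lt_def]
  split_ifs <;> simp_all <;> omega

theorem simpleRefl_mul_eq_of_swap {i j : ℕ} (hi : i + 1 < n) (hj : j + 1 < n)
    {w : Equiv.Perm (Fin n)}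
    (h : (w ⟨i, Nat.lt_of_succ_lt hi⟩ = ⟨j, Nat.lt_of_succ_lt hj⟩ ∧ w ⟨i + 1, hi⟩ = ⟨j + 1, hj⟩) ∨
      (w ⟨i, Nat.lt_of_succ_lt hi⟩ = ⟨j + 1, hj⟩ ∧ w ⟨i + 1, hi⟩ = ⟨j, Nat.lt_of_succ_lt hj⟩)) :
    simpleRefl n j * w = w * simpleRefl n i := by
  rw [simpleRefl_eq hi, simpleRefl_eq hj, simpleSwap, simpleSwap, Equiv.mul_swap_eq_swap_mul]
  rcases h with ⟨h1, h2⟩ | ⟨h1, h2⟩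
  · rw [h1, h2]
  · rw [h1, h2, Equiv.swap_comm]

/-- Left multiplication by `s_j` exchanges the values `j` and `j + 1`. It can affect the comparison
at positions `i`, `i + 1` only if these hold exactly those two values, and then `s_j w = w s_i`. -/
theorem isDescent_simpleRefl_mul {i j : ℕ} {w : Equiv.Perm (Fin n)}
    (h : simpleRefl n j * w ≠ w * simpleRefl n i) :
    IsDescent (simpleRefl n j * w) i ↔ IsDescent w i := by
  refine exists_congr fun hi => ?_
  by_cases hj : j + 1 < n
  · rw [simpleRefl_eq hj, Equiv.Perm.mul_apply, Equiv.Perm.mul_apply]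
    refine simpleSwap_lt_iff hj ?_ ?_
    · exact fun e => h (simpleRefl_mul_eq_of_swap hi hj (Or.inr ⟨Fin.ext e.2, Fin.ext e.1⟩))
    · exact fun e => h (simpleRefl_mul_eq_of_swap hi hj (Or.inl ⟨Fin.ext e.2, Fin.ext e.1⟩))
  · rw [simpleRefl, dif_neg hj, one_mul]

theorem isDescent_inv_iff {i j : ℕ} {w : Equiv.Perm (Fin n)} (hi : i + 1 < n)
    (hj : j + 1 < n) (h : simpleRefl n j * w = w * simpleRefl n i) :
    IsDescent w⁻¹ j ↔ IsDescent w i := by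
  rw [simpleRefl_eq hi, simpleRefl_eq hj, simpleSwap, simpleSwap, Equiv.mul_swap_eq_swap_mul] at h
  have h' := mul_right_cancel h
  set A : Fin n := ⟨i, Nat.lt_of_succ_lt hi⟩ with hA
  set B : Fin n := ⟨i + 1, hi⟩ with hB
  set C : Fin n := ⟨j, Nat.lt_of_succ_lt hj⟩ with hC
  set D : Fin n := ⟨j + 1, hj⟩ with hD
  have hAB : A < B := by simp [hA, hB]
  have hCD : C < D := by simp [hC, hD]
  have d1 : IsDescent w i ↔ w B < w A := by simp [IsDescent, hi, hA, hB]
  have d2 : IsDescent w⁻¹ j ↔ w⁻¹ D < w⁻¹ C := by simp [IsDescent, hj, hC, hD]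
  have hne : w A ≠ w B := fun e => hAB.ne (w.injective e)
  have hC' : Equiv.swap (w A) (w B) C = D := by rw [← h']; exact Equiv.swap_apply_left _ _
  rw [Equiv.swap_apply_def] at hC'
  rw [d1, d2]
  split_ifs at hC' with e1 e2
  · rw [e1, ← hC'] at hCD ⊢
    simp [hAB.not_gt, hCD.not_gt]
  · rw [e2, ← hC'] at hCD ⊢
    simpa [hAB] using hCD
  · exact absurd hC' hCD.ne

/-- Left and right multiplication in an associative algebra commute. Without the algebra at hand,
this is verified on coefficients. -/
theorem heckeOp_comm_heckeOpLeft (β : R) (i j : ℕ) :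
    Commute (heckeOp β i : Module.End R (Equiv.Perm (Fin n) → R)) (heckeOpLeft β j) := by
  by_cases hi : i + 1 < n
  swap
  · rw [heckeOp_of_not_lt β hi]; exact Commute.zero_left _
  by_cases hj : j + 1 < n
  swap
  · rw [heckeOpLeft, heckeOp_of_not_lt β hj, map_zero]; exact Commute.zero_right _
  refine LinearMap.ext fun f => funext fun w => ?_
  simp only [Module.End.mul_apply, heckeOp_apply, heckeOpLeft_apply]
  -- If `s_j w = w s_i`, the left and right descent conditions coincide and both flip when passing
  -- to `w s_i`. Otherwise neither multiplication influences the other's descent condition.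
  by_cases h : simpleRefl n j * w = w * simpleRefl n i
  · have h1 := isDescent_inv_iff hi hj h
    have h2 : IsDescent (w * simpleRefl n i)⁻¹ j ↔ ¬ IsDescent w i := by
      rw [← h, mul_inv_rev, simpleRefl_inv, isDescent_mul_simpleRefl hj, h1]
    have h3 := isDescent_mul_simpleRefl (w := w) hi
    simp only [h1, h2, h, h3]
    by_cases hd : IsDescent w i <;> simp [hd]
  · have h1 := isDescent_simpleRefl_mul h
    have h2 : IsDescent (w * simpleRefl n i)⁻¹ j ↔ IsDescent w⁻¹ j := by
      rw [mul_inv_rev, simpleRefl_inv]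
      refine isDescent_simpleRefl_mul fun e => h ?_
      have := congrArg (·⁻¹) e
      simpa [simpleRefl_inv] using this.symm
    simp only [h1, h2, mul_assoc]
    split_ifs <;> ring

/-- Both sides represent `u_i` itself, the indicator function of `s_i`, which is invariant under
inversion. -/
theorem heckeOp_deltaOne (β : R) (i : ℕ) :
    heckeOp β i (deltaOne n R) = heckeOpLeft β i (deltaOne n R) := by
  funext w
  by_cases hi : i + 1 < n
  swap
  · rw [heckeOpLeft, heckeOp_of_not_lt β hi, map_zero]
  have key : ∀ v : Equiv.Perm (Fin n), heckeOp β i (deltaOne n R) v =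
      if v = simpleRefl n i then 1 else 0 := by
    intro v
    have h1 : ¬ IsDescent (1 : Equiv.Perm (Fin n)) i := by
      rintro ⟨h, h'⟩
      simp [Fin.lt_def] at h'
    rw [heckeOp_apply]
    by_cases hv : v = simpleRefl n i
    · have h2 := (isDescent_mul_simpleRefl (w := (1 : Equiv.Perm (Fin n))) hi).2 h1
      rw [one_mul] at h2
      have h3 : simpleRefl n i ≠ 1 := fun e => h1 (e ▸ h2)
      simp [hv, h2, deltaOne, simpleRefl_mul_self, h3]
    · have h3 : v * simpleRefl n i ≠ 1 := fun e => hv (by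
        rw [← simpleRefl_inv]; exact eq_inv_of_mul_eq_one_left e)
      by_cases hv1 : v = 1
      · simp [hv, hv1 ▸ h1]
      · simp [hv, deltaOne, h3, hv1]
  have hinv : invEquiv (deltaOne n R) = deltaOne n R := by
    funext v
    simp [invEquiv_apply, deltaOne]
  rw [heckeOpLeft, conj_invEquiv_apply, hinv, key, key]
  congr 1
  rw [inv_eq_iff_eq_inv, simpleRefl_inv]

/-- The value of the Fomin-Kirillov product at `x = 1` is invariant under inversion. -/
theorem fkProd_one_inv (β : R) (i k : ℕ) (w : Equiv.Perm (Fin n)) :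
    fkProd (heckeOp β) (fun _ => (1 : R)) i k (deltaOne n R) w⁻¹ =
      fkProd (heckeOp β) (fun _ => (1 : R)) i k (deltaOne n R) w := by
  have hinv : invEquiv (deltaOne n R) = deltaOne n R := by
    funext v
    simp [invEquiv_apply, deltaOne]
  set φ := (invEquiv (n := n) (R := R)).conjRingEquiv with hφ
  have hfac : ∀ j, φ (heckeFactor (heckeOp β) (1 : R) j) =
      heckeFactor (heckeOpLeft β) (1 : R) j := by
    intro j
    simp [heckeFactor, heckeOpLeft, hφ]
  have hcomm : ∀ i j, i + 1 < j → Commute (heckeFactor (heckeOpLeft β) (1 : R) i)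
      (heckeFactor (heckeOpLeft β) (1 : R) j : Module.End R (Equiv.Perm (Fin n) → R)) := by
    intro i j hij
    rw [← hfac, ← hfac]
    exact ((heckeOp_heckeRel β).commute_heckeFactor 1 1 hij).map φ
  have h1 : φ (fkProd (heckeOp β) (fun _ => (1 : R)) i k) =
      triProd (fun _ => heckeFactor (heckeOpLeft β) (1 : R)) i k := by
    have := map_triProd (MonoidHomClass.toMonoidHom φ)
      (fun _ : ℕ => heckeFactor (heckeOp β) (1 : R)) i k
    simp only [MonoidHom.coe_coe, hfac] at this
    exact this
  -- Passing from right to left operators on `deltaOne` reverses the word, and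
  -- `triProd_eq_triProdRev` undoes the reversal. The conjugate `φ` of the product therefore acts on
  -- `deltaOne` as the product itself does.
  have h2 : fkProd (heckeOp β) (fun _ => (1 : R)) i k (deltaOne n R) =
      φ (fkProd (heckeOp β) (fun _ => (1 : R)) i k) (deltaOne n R) := by
    rw [h1, triProd_eq_triProdRev hcomm]
    refine triProd_apply_eq_triProdRev_apply (fun i j => ?_) (fun i => ?_) i k
    · exact (Commute.one_left _).add_left ((Commute.one_right _).add_right
        (((heckeOp_comm_heckeOpLeft β i j).smul_right _).smul_left _))
    · simp [heckeFactor, heckeOp_deltaOne]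
  have h3 := congrFun h2 w
  rw [hφ, conj_invEquiv_apply, hinv] at h3
  exact h3.symm

end Operators

/-! ### Base change of the coefficient ring -/

section Map

variable {n : ℕ} {R S : Type*} [CommRing R] [CommRing S]

theorem map_heckeFactor (φ : R →+* S) (β x : R) (i : ℕ) (f : Equiv.Perm (Fin n) → R) :
    φ ∘ (heckeFactor (heckeOp β) x i f) = heckeFactor (heckeOp (φ β)) (φ x) i (φ ∘ f) := by
  funext w
  simp only [heckeFactor, Function.comp_apply, LinearMap.add_apply, LinearMap.smul_apply,
    Module.End.one_apply, Pi.add_apply, Pi.smul_apply, heckeOp_apply, smul_eq_mul, map_add, map_mul]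
  split_ifs <;> simp

theorem map_ascProd_heckeFactor (φ : R →+* S) (β x : R) (i k : ℕ) (f : Equiv.Perm (Fin n) → R) :
    φ ∘ (ascProd (heckeFactor (heckeOp β) x) i k f) =
      ascProd (heckeFactor (heckeOp (φ β)) (φ x)) i k (φ ∘ f) := by
  induction k generalizing i with
  | zero => rfl
  | succ k ih =>
    simp only [ascProd, Module.End.mul_apply]
    rw [map_heckeFactor, ih]

/-- Used twice: for the interchange of two variables, and for the specialization of all variables to
`1`. -/
theorem map_fkProd (φ : R →+* S) (β : R) (x : ℕ → R) (i k : ℕ) (f : Equiv.Perm (Fin n) → R) :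
    φ ∘ (fkProd (heckeOp β) x i k f) = fkProd (heckeOp (φ β)) (φ ∘ x) i k (φ ∘ f) := by
  induction k generalizing i f with
  | zero => rfl
  | succ k ih =>
    simp only [fkProd_succ, Module.End.mul_apply]
    rw [ih, map_ascProd_heckeFactor]
    rfl

theorem map_deltaOne (φ : R →+* S) : φ ∘ (deltaOne n R) = deltaOne n S := by
  funext w
  simp only [Function.comp_apply, deltaOne]
  split_ifs <;> simp

end Map

/-! ### The coefficient of the longest permutation -/

section Top

variable {n : ℕ} {R : Type*} [CommRing R]

theorem heckeFactor_apply (β x : R) (i : ℕ) (f : Equiv.Perm (Fin n) → R)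
    (w : Equiv.Perm (Fin n)) : heckeFactor (heckeOp β) x i f w =
      f w + x * if IsDescent w i then f (w * simpleRefl n i) + β * f w else 0 := rfl

/-- Applying `s_i` to both positions maps the non-inversions of `w` other than `(i, i + 1)`
injectively to non-inversions of `w s_i`. -/
theorem colength_le_mul_simpleSwap_add_one (w : Equiv.Perm (Fin n)) (i : ℕ) (h : i + 1 < n) :
    colength w ≤ colength (w * simpleSwap i h) + 1 := by
  set s := simpleSwap i h with hs
  have hss : ∀ x, s (s x) = x := fun x => Equiv.swap_apply_self _ _ x
  unfold colength
  set P := Finset.univ.filter fun p : Fin n × Fin n => p.1 < p.2 ∧ w p.1 < w p.2 with hP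
  have h1 : P.card ≤ (P.erase (⟨i, Nat.lt_of_succ_lt h⟩, ⟨i + 1, h⟩)).card + 1 := by
    have := Finset.pred_card_le_card_erase (s := P) (a := (⟨i, Nat.lt_of_succ_lt h⟩, ⟨i + 1, h⟩))
    omega
  refine h1.trans (Nat.add_le_add_right ?_ 1)
  refine Finset.card_le_card_of_injOn (Prod.map s s) ?_
    ((s.injective.prodMap s.injective).injOn)
  rintro ⟨a, b⟩ hab
  replace hab : ¬ (a = ⟨i, Nat.lt_of_succ_lt h⟩ ∧ b = ⟨i + 1, h⟩) ∧ a < b ∧ w a < w b := by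
    have := Finset.mem_erase.1 hab
    simpa [hP] using this
  refine Finset.mem_filter.2 ⟨Finset.mem_univ _, ?_⟩
  simp only [Prod.map_apply, Equiv.Perm.mul_apply, hss]
  refine ⟨(simpleSwap_lt_iff h ?_ ?_).2 hab.2.1, hab.2.2⟩
  · exact fun e => hab.1 ⟨Fin.ext e.1, Fin.ext e.2⟩
  · rintro ⟨e1, e2⟩
    have := hab.2.1
    rw [Fin.lt_def] at this
    omega

theorem colength_mul_simpleRefl_of_isDescent {w : Equiv.Perm (Fin n)} {i : ℕ}
    (hd : IsDescent w i) : colength (w * simpleRefl n i) = colength w + 1 := by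
  obtain ⟨h, hw⟩ := hd
  have h1 := colength_le_mul_simpleSwap_add_one (w * simpleRefl n i) i h
  have h2 := colength_mul_simpleSwap_lt (w * simpleRefl n i) i h (by
    simpa only [simpleRefl_eq h, Equiv.Perm.mul_apply, simpleSwap_apply_left,
      simpleSwap_apply_right] using hw)
  rw [← simpleRefl_eq h, mul_simpleRefl_cancel] at h1 h2
  omega

/-- `f` vanishes on the permutations with more than `m` inversions. -/
def SupportedUpTo (f : Equiv.Perm (Fin n) → R) (m : ℕ) : Prop :=
  ∀ w, colength w + m < colength (1 : Equiv.Perm (Fin n)) → f w = 0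

theorem SupportedUpTo.heckeFactor {f : Equiv.Perm (Fin n) → R} {m : ℕ} (hf : SupportedUpTo f m)
    (β x : R) (i : ℕ) : SupportedUpTo (heckeFactor (heckeOp β) x i f) (m + 1) := by
  intro w hw
  rw [heckeFactor_apply, hf w (by omega)]
  split_ifs with hd
  · rw [hf _ (by rw [colength_mul_simpleRefl_of_isDescent hd]; omega)]
    ring
  · ring

theorem SupportedUpTo.ascProd {f : Equiv.Perm (Fin n) → R} {m : ℕ} (hf : SupportedUpTo f m)
    (β x : R) (i k : ℕ) :
    SupportedUpTo (ascProd (GrothendieckSpecialization.heckeFactor (heckeOp β) x) i k f)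
      (m + k) := by
  induction k generalizing i with
  | zero => exact hf
  | succ k ih => exact (ih (i + 1)).heckeFactor β x i

theorem SupportedUpTo.heckeFactor_top {f : Equiv.Perm (Fin n) → R} {m : ℕ}
    (hf : SupportedUpTo f m) (β x : R) {i : ℕ} {w : Equiv.Perm (Fin n)} (hd : IsDescent w i)
    (hw : colength w + m < colength (1 : Equiv.Perm (Fin n))) :
    GrothendieckSpecialization.heckeFactor (heckeOp β) x i f w = x * f (w * simpleRefl n i) := by
  rw [heckeFactor_apply, hf w hw, if_pos hd]
  ring

/-- The entry of `w` at each position `a < i` exceeds all the entries to its right. -/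
def DecreasingBelow (w : Equiv.Perm (Fin n)) (i : ℕ) : Prop :=
  ∀ a b : Fin n, (a : ℕ) < i → a < b → w b < w a

/-- At the maximal possible length every factor must contribute its term `x u_j`, so a single path
survives. Along it the entry at position `j`, larger than all entries to its right, is pushed to the
last position, at the cost of one `x` per step. -/
theorem SupportedUpTo.ascProd_top {f : Equiv.Perm (Fin n) → R} {m : ℕ}
    (hf : SupportedUpTo f m) (β x : R) {i j k : ℕ} (hij : i ≤ j) (hjk : j + k + 1 = n)
    {w : Equiv.Perm (Fin n)} (hw : DecreasingBelow w i)
    (hj : ∀ a b : Fin n, (a : ℕ) = j → a < b → w b < w a)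
    (hc : colength w + (m + k) = colength (1 : Equiv.Perm (Fin n))) :
    ∃ v, DecreasingBelow v i ∧ colength v + m = colength (1 : Equiv.Perm (Fin n)) ∧
      GrothendieckSpecialization.ascProd (GrothendieckSpecialization.heckeFactor (heckeOp β) x)
        j k f w = x ^ k * f v := by
  induction k generalizing j w with
  | zero => exact ⟨w, hw, hc, by simp [GrothendieckSpecialization.ascProd]⟩
  | succ k ih =>
    have hjn : j + 1 < n := by omega
    have hd : IsDescent w j := ⟨hjn, hj _ _ rfl (by simp)⟩
    have hlen := colength_mul_simpleRefl_of_isDescent hd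
    have hbelow : ∀ a b : Fin n, (a : ℕ) < j → a < b → a < simpleSwap j hjn b := by
      intro a b ha hab
      have h := (simpleSwap_lt_iff hjn (p := a) (q := b) (by omega) (by omega)).2 hab
      rwa [simpleSwap_apply_of_ne hjn (by omega) (by omega)] at h
    -- The dominating entry has moved from position `j` to `j + 1`, and positions below `i` are
    -- untouched.
    obtain ⟨v, h1, h2, h3⟩ := ih (j := j + 1) (w := w * simpleRefl n j) (by omega) (by omega)
      (by
        intro a b ha hab
        rw [simpleRefl_eq hjn, Equiv.Perm.mul_apply, Equiv.Perm.mul_apply,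
          simpleSwap_apply_of_ne hjn (a := a) (by omega) (by omega)]
        exact hw a _ ha (hbelow a b (by omega) hab))
      (by
        intro a b ha hab
        obtain rfl : a = ⟨j + 1, hjn⟩ := Fin.ext ha
        have hab' : j + 1 < (b : ℕ) := hab
        rw [simpleRefl_eq hjn, Equiv.Perm.mul_apply, Equiv.Perm.mul_apply,
          simpleSwap_apply_right,
          simpleSwap_apply_of_ne hjn (a := b) (by omega) (by omega)]
        exact hj _ _ rfl (by rw [Fin.lt_def]; simp only; omega))
      (by omega)
    refine ⟨v, h1, h2, ?_⟩
    rw [GrothendieckSpecialization.ascProd, Module.End.mul_apply,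
      (hf.ascProd β x (j + 1) k).heckeFactor_top β x hd (by omega), h3]
    ring

/-- The row with variable `x i` has `k - 1` factors and acts first on `f`, so it is resolved last
when starting from `w`. Each row extracts its full power of its variable and gives up one decreasing
position. -/
theorem SupportedUpTo.fkProd_top {f : Equiv.Perm (Fin n) → R} {m : ℕ}
    (hf : SupportedUpTo f m) (β : R) (x : ℕ → R) {i k : ℕ} (hik : i + k = n)
    {w : Equiv.Perm (Fin n)} (hw : DecreasingBelow w n)
    (hc : colength w + (m + ∑ j ∈ Finset.range k, j) = colength (1 : Equiv.Perm (Fin n))) :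
    ∃ v, DecreasingBelow v i ∧ colength v + m = colength (1 : Equiv.Perm (Fin n)) ∧
      fkProd (heckeOp β) x i k f w =
        (∏ j ∈ Finset.range k, x (i + j) ^ (k - 1 - j)) * f v := by
  induction k generalizing i m f with
  | zero =>
    obtain rfl : i = n := hik
    exact ⟨w, hw, by simpa using hc, by simp [fkProd, triProd]⟩
  | succ k ih =>
    rw [Finset.sum_range_succ] at hc
    obtain ⟨v, h1, h2, h3⟩ := ih (hf.ascProd β (x i) i k) (i := i + 1) (by omega) (by omega)
    obtain ⟨u, h4, h5, h6⟩ := hf.ascProd_top β (x i) (le_refl i) (by omega : i + k + 1 = n)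
      (w := v) (fun a b ha => h1 a b (by omega)) (fun a b ha => h1 a b (by omega)) h2
    refine ⟨u, h4, h5, ?_⟩
    rw [fkProd_succ, Module.End.mul_apply, h3, h6, Finset.prod_range_succ', ← mul_assoc]
    congr 1
    congr 1
    refine Finset.prod_congr rfl fun j _ => ?_
    rw [show i + 1 + j = i + (j + 1) by ring, show k + 1 - 1 - (j + 1) = k - 1 - j by omega]

theorem colength_one : colength (1 : Equiv.Perm (Fin n)) = ∑ j ∈ Finset.range n, j := by
  unfold colength
  simp only [Equiv.Perm.one_apply, and_self]
  rw [← Finset.sum_range_reflect, ← Fin.sum_univ_eq_sum_range (fun j => n - 1 - j),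
    Finset.card_filter, ← Finset.univ_product_univ, Finset.sum_product]
  refine Finset.sum_congr rfl fun a _ => ?_
  rw [← Finset.card_filter, Finset.filter_lt_eq_Ioi, Fin.card_Ioi]

theorem colength_revPerm : colength (Fin.revPerm : Equiv.Perm (Fin n)) = 0 := by
  unfold colength
  rw [Finset.card_eq_zero, Finset.filter_eq_empty_iff]
  rintro ⟨a, b⟩ - ⟨h1, h2⟩
  exact h1.asymm (Fin.rev_lt_rev.1 h2)

theorem eq_one_of_colength {w : Equiv.Perm (Fin n)}
    (h : colength w = colength (1 : Equiv.Perm (Fin n))) : w = 1 := by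
  unfold colength at h
  simp only [Equiv.Perm.one_apply, and_self] at h
  have heq := Finset.eq_of_subset_of_card_le (Finset.monotone_filter_right Finset.univ
    (fun (p : Fin n × Fin n) _ (hp : p.1 < p.2 ∧ w p.1 < w p.2) => hp.1)) h.ge
  have hmono : StrictMono w := fun a b hab => by
    have hm : (a, b) ∈ Finset.univ.filter fun p : Fin n × Fin n => p.1 < p.2 := by simpa using hab
    rw [← heq] at hm
    exact (Finset.mem_filter.1 hm).2.2
  ext x
  have hx := DFunLike.congr_fun (Subsingleton.elim (hmono.orderIsoOfSurjective _ w.surjective)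
    (OrderIso.refl (Fin n))) x
  simp only [StrictMono.coe_orderIsoOfSurjective, OrderIso.refl_apply] at hx
  rw [hx, Equiv.Perm.one_apply]

/-- The product has exactly as many factors as `w₀` has inversions, so the surviving path from `w₀`
must end at the identity. -/
theorem fkProd_revPerm (β : R) (x : ℕ → R) :
    fkProd (heckeOp β) x 0 n (deltaOne n R) Fin.revPerm = ∏ i : Fin n, x i ^ (n - 1 - (i : ℕ)) := by
  have hf : SupportedUpTo (deltaOne n R) 0 := fun w hw => if_neg fun h => by
    simp [h] at hw
  obtain ⟨v, -, h2, h3⟩ := hf.fkProd_top β x (i := 0) (k := n) (zero_add n) (w := Fin.revPerm)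
    (fun a b _ hab => Fin.rev_lt_rev.2 hab) (by rw [colength_revPerm, colength_one]; ring)
  rw [h3, eq_one_of_colength h2, deltaOne, if_pos rfl, mul_one,
    ← Fin.prod_univ_eq_prod_range (fun i => x (0 + i) ^ (n - 1 - i))]
  simp

end Top

/-! ### Grothendieck polynomials as coefficients of the Fomin-Kirillov product -/

section Grothendieck

variable {n : ℕ}

variable (n) in
/-- The variables `x_i`, and `0` outside the range. -/
noncomputable def varSeq (i : ℕ) : PolyRing n :=
  if h : i < n then MvPolynomial.X ⟨i, h⟩ else 0

theorem varSeq_of_lt {i : ℕ} (h : i < n) : varSeq n i = MvPolynomial.X ⟨i, h⟩ := dif_pos h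

/-- The coefficients of the Fomin-Kirillov product. -/
noncomputable def fkCoeff (w : Equiv.Perm (Fin n)) : PolyRing n :=
  fkProd (heckeOp (beta n)) (varSeq n) 0 n (deltaOne n (PolyRing n)) w

theorem act_fkCoeff {i : ℕ} (h : i + 1 < n) (w : Equiv.Perm (Fin n)) :
    act (simpleSwap i h) (fkCoeff w) =
      fkProd (heckeOp (beta n)) (varSeq n ∘ Equiv.swap i (i + 1)) 0 n
        (deltaOne n (PolyRing n)) w := by
  set φ : PolyRing n →+* PolyRing n :=
    (MvPolynomial.rename (R := Polynomial ℤ) (simpleSwap i h)).toRingHom with hφ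
  have hβ : φ (beta n) = beta n := by simp [hφ, beta]
  have hx : φ ∘ varSeq n = varSeq n ∘ Equiv.swap i (i + 1) := by
    funext j
    simp only [Function.comp_apply]
    by_cases h1 : j = i
    · rw [h1, Equiv.swap_apply_left, varSeq_of_lt (by omega), varSeq_of_lt h]
      simp [hφ, simpleSwap_apply_left]
    by_cases h2 : j = i + 1
    · rw [h2, Equiv.swap_apply_right, varSeq_of_lt h, varSeq_of_lt (by omega)]
      simp [hφ, simpleSwap_apply_right]
    rw [Equiv.swap_apply_of_ne_of_ne h1 h2]
    unfold varSeq
    split_ifs with h3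
    · simp [hφ, simpleSwap_apply_of_ne h (a := ⟨j, h3⟩) h1 h2]
    · exact map_zero φ
  have := congrFun (map_fkProd φ (beta n) (varSeq n) 0 n (deltaOne n (PolyRing n))) w
  rw [hβ, hx, map_deltaOne] at this
  exact this

/-- The exchange identity `heckeFactor_mul_fkProd` is read off at the two permutations `w` and `w
s_i`. Eliminating `s_i · fkCoeff w` between the two equations leaves the defining equation of `π_i`.
-/
theorem fkCoeff_of_isAscent (w : Equiv.Perm (Fin n)) (i : ℕ) (h : i + 1 < n)
    (hw : w ⟨i, Nat.lt_of_succ_lt h⟩ < w ⟨i + 1, h⟩) :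
    fkCoeff w = isobaric ⟨i, Nat.lt_of_succ_lt h⟩ ⟨i + 1, h⟩ (fkCoeff (w * simpleSwap i h)) := by
  have hd : ¬ IsDescent w i := fun ⟨_, h'⟩ => hw.asymm h'
  have hd' := (isDescent_mul_simpleRefl (w := w) h).2 hd
  have key := (heckeOp_heckeRel (n := n) (beta n)).heckeFactor_mul_fkProd (varSeq n)
    (Nat.zero_le i) (by omega : i + 1 < 0 + n)
  have key1 := fun v => congrFun (DFunLike.congr_fun key (deltaOne n (PolyRing n))) v
  simp only [Module.End.mul_apply, heckeFactor_apply, ← act_fkCoeff h] at key1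
  -- At the ascent `w` the `u_i` terms vanish, so `e1` says that `fkCoeff w` is invariant under
  -- `s_i`. At `w s_i`, a descent, `e2` relates `fkCoeff w` and `fkCoeff (w s_i)` to their images
  -- under `s_i`.
  have e1 := key1 w
  have e2 := key1 (w * simpleRefl n i)
  rw [if_neg hd, if_neg hd] at e1
  rw [if_pos hd', if_pos hd', mul_simpleRefl_cancel, varSeq_of_lt h,
    varSeq_of_lt (Nat.lt_of_succ_lt h)] at e2
  rw [simpleRefl_eq h] at e2
  change fkCoeff w + _ = act (simpleSwap i h) (fkCoeff w) + _ at e1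
  change fkCoeff (w * simpleSwap i h) + _ * (fkCoeff w + _ * fkCoeff (w * simpleSwap i h)) = _ at e2
  refine mul_left_cancel₀ (X_sub_X_ne (i := ⟨i, Nat.lt_of_succ_lt h⟩) (j := ⟨i + 1, h⟩)
    (by simp)) ?_
  rw [isobaric_spec]
  rw [simpleSwap] at e1 e2 ⊢
  linear_combination (-1 : PolyRing n) * e2 +
    MvPolynomial.X (⟨i, Nat.lt_of_succ_lt h⟩ : Fin n) * e1

/-- `𝔊_w` is the coefficient of `w` in the Fomin-Kirillov product. -/
theorem grothendieck_eq_fkCoeff (w : Equiv.Perm (Fin n)) : grothendieck w = fkCoeff w := by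
  induction hN : colength w using Nat.strong_induction_on generalizing w with
  | _ N ih =>
    by_cases hw : w = Fin.revPerm
    · rw [grothendieck, dif_pos hw, hw, fkCoeff, fkProd_revPerm]
      exact Finset.prod_congr rfl fun i _ => by rw [varSeq_of_lt i.isLt]
    · obtain ⟨i, h, hi⟩ := exists_isAscent hw
      rw [grothendieck_of_isAscent w i h hi, fkCoeff_of_isAscent w i h hi,
        ih _ (hN ▸ colength_mul_simpleSwap_lt w i h hi) _ rfl]

theorem upsilon_eq_fkProd (w : Equiv.Perm (Fin n)) :
    upsilon w = fkProd (heckeOp (Polynomial.X : Polynomial ℤ)) (fun _ => (1 : Polynomial ℤ)) 0 n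
      (deltaOne n (Polynomial ℤ)) w := by
  set φ : PolyRing n →+* Polynomial ℤ := MvPolynomial.eval fun _ => 1 with hφ
  have hβ : φ (beta n) = Polynomial.X := by simp [hφ, beta]
  have hsum := congrFun (map_fkProd φ (beta n) (varSeq n) 0 n (deltaOne n (PolyRing n))) w
  rw [hβ, map_deltaOne] at hsum
  rw [upsilon, grothendieck_eq_fkCoeff]
  refine hsum.trans ?_
  -- The specialized sequence is `0`, not `1`, from index `n` on. The constraint `i + k = n` ensures
  -- that only indices below `n` are used.
  have hcongr : ∀ (k i : ℕ), i + k = n → ∀ f : Equiv.Perm (Fin n) → Polynomial ℤ,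
      fkProd (heckeOp (Polynomial.X : Polynomial ℤ)) (φ ∘ varSeq n) i k f =
        fkProd (heckeOp (Polynomial.X : Polynomial ℤ)) (fun _ => (1 : Polynomial ℤ)) i k f := by
    intro k
    induction k with
    | zero => intro _ _ _; rfl
    | succ k ih =>
      intro i hi f
      have h1 : φ (varSeq n i) = 1 := by
        rw [varSeq_of_lt (by omega)]
        simp [hφ]
      simp only [fkProd_succ, Module.End.mul_apply, Function.comp_apply, h1]
      exact ih (i + 1) (by omega) _
  rw [hcongr n 0 (zero_add n)]

theorem upsilon_inv (w : Equiv.Perm (Fin n)) : upsilon w⁻¹ = upsilon w := by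
  rw [upsilon_eq_fkProd, upsilon_eq_fkProd, fkProd_one_inv]

end Grothendieck

/-! ### Pattern counts under inversion -/

section Patterns

/-- The occurrence of `v⁻¹` in `w⁻¹` given by the values of an occurrence of `v` in `w`. -/
def patternInv {m n : ℕ} (v : Equiv.Perm (Fin m)) (w : Equiv.Perm (Fin n))
    (e : {e : Fin m ↪o Fin n // ∀ a b : Fin m, v a < v b ↔ w (e a) < w (e b)}) :
    {e : Fin m ↪o Fin n // ∀ a b : Fin m, v⁻¹ a < v⁻¹ b ↔ w⁻¹ (e a) < w⁻¹ (e b)} :=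
  ⟨OrderEmbedding.ofStrictMono (fun a => w (e.1 (v⁻¹ a))) fun a b hab =>
      (e.2 _ _).1 (by simpa using hab),
    fun a b => by simp⟩

/-- The values of an occurrence determine its positions, so `patternInv` is injective. Applying the
inequality to the inverses as well gives equality. -/
theorem patternCount_le_inv {m n : ℕ} (v : Equiv.Perm (Fin m)) (w : Equiv.Perm (Fin n)) :
    patternCount v w ≤ patternCount v⁻¹ w⁻¹ := by
  refine Nat.card_le_card_of_injective (patternInv v w) fun e e' h => ?_
  refine Subtype.ext (RelEmbedding.ext fun a => ?_)
  have := DFunLike.congr_fun (congrArg Subtype.val h) (v a)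
  simpa [patternInv] using this

theorem patternCount_inv {m n : ℕ} (v : Equiv.Perm (Fin m)) (w : Equiv.Perm (Fin n)) :
    patternCount v⁻¹ w⁻¹ = patternCount v w :=
  le_antisymm (by simpa using patternCount_le_inv v⁻¹ w⁻¹) (patternCount_le_inv v w)

end Patterns

end GrothendieckSpecialization

/-! ### The inverse conservation principle -/

theorem mainTheorem6 (n : ℕ) (w : Equiv.Perm (Fin n)) :
    GrothendieckSpecialization.patternCoeff w = GrothendieckSpecialization.patternCoeff w⁻¹ := by
  induction n using Nat.strong_induction_on with
  | _ n ih =>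
    cases n with
    | zero => rw [Subsingleton.elim w⁻¹ w]
    | succ n =>
      rw [GrothendieckSpecialization.patternCoeff, GrothendieckSpecialization.patternCoeff,
        GrothendieckSpecialization.upsilon_inv]
      congr 1
      refine Finset.sum_congr rfl fun m _ => ?_
      -- Reindexed by `v ↦ v⁻¹`, the sum for `w` has terms `c_{v⁻¹} p_{v⁻¹}(w)`, which equal `c_v
      -- p_v(w⁻¹)` by induction and `patternCount_inv`.
      rw [← Equiv.sum_comp (Equiv.inv (Equiv.Perm (Fin m)))]
      refine Finset.sum_congr rfl fun v _ => ?_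
      rw [Equiv.inv_apply, ← ih m m.isLt v, ← GrothendieckSpecialization.patternCount_inv v⁻¹ w,
        inv_inv]
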